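/- Let $X$ be a compact connected complex manifold of dimension $m$ and $L\to X$ a holomorphic line bundle with a smooth Hermitian metric $h$ whose curvature form $c_1(h)=dd^c\phi_\alpha$ is strictly positive, where $\|e_\alpha\|_h=e^{-\phi_\alpha}$ for local holomorphic frames $e_\alpha$ of $L$ (so $X$ is projective). Let $h_n=h^{\otimes n}$ be the induced metric on $L^n$, $\|\cdot\|_{h_n}$ its norm, and $d_n=\dim H^0(X,L^n)$. Let $K\subset X$ be compact and non-pluripolar, i.e. there is no quasi-plurisubharmonic function $\varphi\not\equiv-\infty$ on $X$ with $K\subset\{\varphi=-\infty\}$. Let $q:K\to\mathbb R$ be continuous and let $\mu$ be a finite positive Borel measure on $X$ with $\mu(X\setminus K)=0$ and $\mu(K)>0$. Assume that there are $C_0>0$, an integer $n_0\ge 1$ and numbers $M_n\le n^{C_0}$ such that for all $n\ge n_0$ and all $s\in H^0(X,L^n)$ $$\max_K\|s\|_{h_n}^2e^{-2nq}\le M_n\int_K\|s\|_{h_n}^2e^{-2nq}\,d\mu .$$ Then, for every $n\ge n_0$, the space $H^0(X,L^n)$ is finite-dimensional and has an orthonormal basis $S_{n1},\dots,S_{nd_n}$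 with respect to $$\langle s_1,s_2\rangle=\int_K h_n(s_1,s_2)e^{-2nq}\,d\mu .$$ For any such basis put $B_n(x)=\sum_{j=1}^{d_n}\|S_{nj}(x)\|_{h_n}^2$, and put $$\Phi_n(x)=\sup\{\|s(x)\|_{h_n}: s\in H^0(X,L^n),\ \max_K\|s\|_{h_n}e^{-nq}\le 1\}.$$ Proposition 4.1. For all $n\ge n_0$ and all $x\in X$ one has $\Phi_n(x)<\infty$ and $$\Phi_n(x)^2\le\mu(K)\,d_n\,B_n(x),\qquad B_n(x)\le n^{C_0}d_n\,\Phi_n(x)^2 .$$ If $x$ is not a base point of $L^n$ (some $s\in H^0(X,L^n)$ has $s(x)\ne0$), then $\Phi_n(x)>0$, $B_n(x)>0$ and $$\frac1{\mu(K)d_n}\le\frac{B_n(x)}{\Phi_n(x)^2}\le n^{C_0}d_n .$$ Moreover there is a constant $C$, independent of $n$ and $x$, such that for all $n\ge\max(n_0,2)$ and all $x\in X$ that are not base points of $L^n$ $$\left|\frac1{2n}\log B_n(x)-\frac1n\log\Phi_n(x)\right|\le C\,\frac{\log n}{n}.$$ -/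

import Mathlib

open scoped Manifold ContDiff
open MeasureTheory

noncomputable section

namespace HolLineBundle

/-! Holomorphic line bundles on a complex manifold `X` modelled on `E` are given by holomorphic
transition functions: `L : VectorBundleCore ℂ X ℂ ι` with `[L.IsContMDiff 𝓘(ℂ, E) ω]`. -/

section Power

variable {X ι : Type*} [TopologicalSpace X]

/-- The transition function `g_{ij}` of a line bundle: `s_i = g_{ij} s_j` for the coordinates
`s_i`, `s_j` of a section in the trivializations `i`, `j`. -/
def transition (L : VectorBundleCore ℂ X ℂ ι) (i j : ι) (x : X) : ℂ :=
  L.coordChange j i x 1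

theorem coordChange_apply (L : VectorBundleCore ℂ X ℂ ι) (i j : ι) (x : X) (v : ℂ) :
    L.coordChange i j x v = transition L j i x * v := by
  have := (L.coordChange i j x).map_smul v 1
  simpa [transition, mul_comm] using this

/-- The `n`-th tensor power of a line bundle: same trivializing cover, transition functions
`g_{ij} ^ n`. -/
def power (L : VectorBundleCore ℂ X ℂ ι) (n : ℕ) : VectorBundleCore ℂ X ℂ ι where
  baseSet := L.baseSet
  isOpen_baseSet := L.isOpen_baseSet
  indexAt := L.indexAt
  mem_baseSet_at := L.mem_baseSet_at
  coordChange i j x := (transition L j i x) ^ n • ContinuousLinearMap.id ℂ ℂ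
  coordChange_self i x hx v := by
    simp [transition, L.coordChange_self i x hx]
  continuousOn_coordChange i j := by
    have h : ContinuousOn (fun x => transition L j i x) (L.baseSet i ∩ L.baseSet j) :=
      (L.continuousOn_coordChange i j).clm_apply continuousOn_const
    exact (h.pow n).smul continuousOn_const
  coordChange_comp i j k x hx v := by
    have h := L.coordChange_comp i j k x hx 1
    simp only [coordChange_apply, mul_one] at h
    simp [← h, mul_pow, mul_assoc]

end Power

section Sections

variable (E : Type*) [NormedAddCommGroup E] [NormedSpace ℂ E]
variable {X ι : Type*} [TopologicalSpace X] [ChartedSpace E X]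

/-- The space `H⁰(X, Lⁿ)` of global holomorphic sections of `Lⁿ`. The value `s x` of a section is
its coordinate in the trivialization `L.indexAt x` around `x`. -/
abbrev H0 (L : VectorBundleCore ℂ X ℂ ι) (n : ℕ) : Type _ :=
  ContMDiffSection 𝓘(ℂ, E) ℂ ω (power L n).Fiber

/-- `d_n = dim H⁰(X, Lⁿ)`. -/
def dimH0 (L : VectorBundleCore ℂ X ℂ ι) (n : ℕ) : ℕ := Module.finrank ℂ (H0 E L n)

/-- A smooth Hermitian metric `h` on `L`, given by its local weights `φ_i`, that is
`‖e_i‖_h = exp (-φ_i)` for the local frame `e_i` of the trivialization `i`. -/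
structure SmoothMetric (L : VectorBundleCore ℂ X ℂ ι) where
  weight : ι → X → ℝ
  contMDiffOn_weight : ∀ i, ContMDiffOn 𝓘(ℝ, E) 𝓘(ℝ, ℝ) ∞ (weight i) (L.baseSet i)
  weight_eq : ∀ i j, ∀ x ∈ L.baseSet i ∩ L.baseSet j,
    weight i x = weight j x + Real.log ‖transition L i j x‖

variable {E}

/-- Four times the Levi form `∑ ∂²u/∂z_j∂z̄_k (z) v_j v̄_k` of a smooth real function `u`. -/
def leviForm (u : E → ℝ) (z v : E) : ℝ :=
  iteratedFDeriv ℝ 2 u z ![v, v] + iteratedFDeriv ℝ 2 u z ![Complex.I • v, Complex.I • v]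

/-- The curvature form `c₁(h) = ddᶜ φ_i` is strictly positive. -/
def SmoothMetric.IsPositive {L : VectorBundleCore ℂ X ℂ ι} (h : SmoothMetric E L) : Prop :=
  ∀ i, ∀ e ∈ atlas E X, ∀ z ∈ e.target, e.symm z ∈ L.baseSet i →
    ∀ v : E, v ≠ 0 → 0 < leviForm (fun w => h.weight i (e.symm w)) z v

/-- The Hermitian form `h_n = h^{⊗ n}` on the fibre of `Lⁿ` at `x`, on coordinates in the
trivialization `L.indexAt x`. -/
def SmoothMetric.form {L : VectorBundleCore ℂ X ℂ ι} (h : SmoothMetric E L) (n : ℕ) (x : X)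
    (u v : ℂ) : ℂ :=
  u * (starRingEnd ℂ) v * (Real.exp (-(2 * n * h.weight (L.indexAt x) x)) : ℝ)

/-- The norm `‖v‖_{h_n} = h_n(v, v)^{1/2}` on the fibre of `Lⁿ` at `x`. -/
def SmoothMetric.nrm {L : VectorBundleCore ℂ X ℂ ι} (h : SmoothMetric E L) (n : ℕ) (x : X)
    (v : ℂ) : ℝ :=
  ‖v‖ * Real.exp (-(n * h.weight (L.indexAt x) x))

theorem SmoothMetric.form_self {L : VectorBundleCore ℂ X ℂ ι} (h : SmoothMetric E L) (n : ℕ)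
    (x : X) (v : ℂ) : h.form n x v v = ((h.nrm n x v ^ 2 : ℝ) : ℂ) := by
  unfold SmoothMetric.form SmoothMetric.nrm
  rw [Complex.mul_conj, mul_pow, ← Real.exp_nat_mul, Complex.normSq_eq_norm_sq]
  push_cast
  ring_nf

end Sections

section Pluripotential

variable {E : Type*} [NormedAddCommGroup E] [NormedSpace ℂ E]

/-- Plurisubharmonic functions `u : U → [-∞, ∞)` on an open set `U`: upper semicontinuous, with
`u a` at most the mean value of `u` over the boundary of each complex disc
`{a + ζ b : |ζ| ≤ 1}` in `U`. As `u` is upper semicontinuous, that mean value (possibly `-∞`) is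
the infimum of the mean values of the continuous real functions `g ≥ u` on the circle. -/
def IsPSHOn (u : E → EReal) (U : Set E) : Prop :=
  UpperSemicontinuousOn u U ∧ (∀ z ∈ U, u z ≠ ⊤) ∧
    ∀ a b : E, (∀ ζ : ℂ, ‖ζ‖ ≤ 1 → a + ζ • b ∈ U) →
      ∀ g : ℂ → ℝ, Continuous g → (∀ ζ : ℂ, ‖ζ‖ = 1 → u (a + ζ • b) ≤ (g ζ : EReal)) →
        u a ≤ ((Real.circleAverage g 0 1 : ℝ) : EReal)

variable {X : Type*} [TopologicalSpace X] [ChartedSpace E X]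

variable (E) in
/-- Quasi-plurisubharmonic functions `X → [-∞, ∞)`: upper semicontinuous and locally the sum of a
plurisubharmonic function and a smooth one. -/
def IsQPSH (φ : X → EReal) : Prop :=
  UpperSemicontinuous φ ∧ (∀ x, φ x ≠ ⊤) ∧
    ∀ x : X, ∃ e ∈ atlas E X, ∃ U : Set E, x ∈ e.source ∧ IsOpen U ∧ e x ∈ U ∧ U ⊆ e.target ∧
      ∃ (u : E → EReal) (ρ : E → ℝ), IsPSHOn u U ∧ ContDiffOn ℝ ∞ ρ U ∧
        ∀ z ∈ U, φ (e.symm z) = u z + (ρ z : EReal)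

variable (E) in
/-- `K` is pluripolar: contained in `{φ = -∞}` for some quasi-plurisubharmonic `φ ≢ -∞`
(`X` connected). -/
def IsPluripolar (K : Set X) : Prop :=
  ∃ φ : X → EReal, IsQPSH E φ ∧ (∃ x, φ x ≠ ⊥) ∧ ∀ x ∈ K, φ x = ⊥

end Pluripotential

section Bergman

variable {E : Type*} [NormedAddCommGroup E] [NormedSpace ℂ E]
variable {X ι : Type*} [TopologicalSpace X] [ChartedSpace E X] [MeasurableSpace X]
variable {L : VectorBundleCore ℂ X ℂ ι}

/-- The Bernstein-Markov inequality of special type for `(K, q, μ)`, in the degrees `n ≥ n₀`, with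
constants `M_n ≤ n ^ C₀`. -/
def BernsteinMarkov (h : SmoothMetric E L) (K : Set X) (q : X → ℝ) (μ : Measure X)
    (C₀ : ℝ) (n₀ : ℕ) : Prop :=
  ∃ M : ℕ → ℝ, ∀ n ≥ n₀, M n ≤ (n : ℝ) ^ C₀ ∧
    ∀ s : H0 E L n, ∀ x ∈ K,
      h.nrm n x (s x) ^ 2 * Real.exp (-(2 * n * q x)) ≤
        M n * ∫ y in K, h.nrm n y (s y) ^ 2 * Real.exp (-(2 * n * q y)) ∂μ

/-- The inner product `∫_K h_n(s₁, s₂) e^{-2nq} dμ` on `H⁰(X, Lⁿ)`. -/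
def innerK (h : SmoothMetric E L) (K : Set X) (q : X → ℝ) (μ : Measure X) (n : ℕ)
    (s₁ s₂ : H0 E L n) : ℂ :=
  ∫ y in K, h.form n y (s₁ y) (s₂ y) * (Real.exp (-(2 * n * q y)) : ℝ) ∂μ

/-- The basis `S` of `H⁰(X, Lⁿ)` is orthonormal for `innerK`. -/
def IsOrthonormalBasis (h : SmoothMetric E L) (K : Set X) (q : X → ℝ) (μ : Measure X) (n : ℕ)
    (S : Module.Basis (Fin (dimH0 E L n)) ℂ (H0 E L n)) : Prop :=
  ∀ i j, innerK h K q μ n (S i) (S j) = if i = j then 1 else 0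

/-- The weighted Bergman kernel function `B_n(x) = ∑_j ‖S_{nj}(x)‖²_{h_n}` of a basis. -/
def bergman (h : SmoothMetric E L) (n : ℕ)
    (S : Module.Basis (Fin (dimH0 E L n)) ℂ (H0 E L n)) (x : X) : ℝ :=
  ∑ j, h.nrm n x (S j x) ^ 2

/-- The numbers `‖s(x)‖_{h_n}` for `s ∈ H⁰(X, Lⁿ)` with `max_K ‖s‖_{h_n} e^{-nq} ≤ 1`. -/
def phiSet (h : SmoothMetric E L) (K : Set X) (q : X → ℝ) (n : ℕ) (x : X) : Set ℝ :=
  {r | ∃ s : H0 E L n,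
    (∀ y ∈ K, h.nrm n y (s y) * Real.exp (-(n * q y)) ≤ 1) ∧ r = h.nrm n x (s x)}

/-- `Φ_n(x)`, the supremum of `phiSet`. -/
def Phi (h : SmoothMetric E L) (K : Set X) (q : X → ℝ) (n : ℕ) (x : X) : ℝ :=
  sSup (phiSet h K q n x)

end Bergman

end HolLineBundle

end

/-!
Expanding a section with `‖s‖ e^{-nq} ≤ 1` on `K` in an orthonormal basis and applying
Cauchy-Schwarz gives `Φ_n² ≤ μ(K) B_n`, since its squared norm for `innerK` is at most `μ(K)`.
Conversely the Bernstein-Markov inequality bounds each `‖S_{nj}‖ e^{-nq}` on `K` by `n^{C₀/2}`, so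
that `n^{-C₀/2} S_{nj}` competes in the definition of `Φ_n`, and summing over `j` gives
`B_n ≤ n^{C₀} d_n Φ_n²`.

Three facts lie behind this.

* `innerK` is definite. If the integral of `‖s‖²` vanishes, then by Bernstein-Markov `s = 0` on `K`.
  By Jensen's formula `log ‖s‖` is quasi-plurisubharmonic (`isQPSH_log_nrm`), so `s ≠ 0` would make
  `K` pluripolar (`eq_zero_of_eqOn_zero`).
* `H⁰(X, Lⁿ)` is finite-dimensional.
* `d_n` grows at most polynomially in `n`, so that `log d_n = O(log n)` in the last estimate.

The last two come together from Siegel's argument (`exists_dimH0_le`). Cover `X` by finitely many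
small balls in charts, such that the weights differ by at most `1/2` from their central values
on balls that are larger by the factor `e`.
If `s` vanishes to order `> n` at all the centres, the higher-order Schwarz lemma at a point where
`‖s‖` attains its maximum `M` gives `M ≤ e^{-1} M`, hence `s = 0`. So `H⁰(X, Lⁿ)` embeds into the
space of `n`-jets at the centres, which is described by `O(n^{m + 1})` numbers.
-/

namespace HolLineBundle
open Metric Set Filter Topology

/-! ### Plurisubharmonicity of `log |f|` -/

/-- The sub-mean value property of `log |f|`: all the terms for the zeros of `f` in Jensen's
formula are nonnegative. -/
theorem log_norm_le_circleAverage {f : ℂ → ℂ} (hf : AnalyticOnNhd ℂ f (closedBall 0 1))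
    (h0 : f 0 ≠ 0) :
    Real.log ‖f 0‖ ≤ Real.circleAverage (fun z => Real.log ‖f z‖) 0 1 := by
  have hf' : AnalyticOnNhd ℂ f (closedBall 0 |1|) := by simpa using hf
  rw [AnalyticOnNhd.circleAverage_log_norm one_ne_zero hf' h0]
  refine le_add_of_nonneg_left (finsum_nonneg fun u => ?_)
  by_cases hu : u ∈ closedBall (0 : ℂ) |1|
  · refine mul_nonneg ?_ ?_
    · exact_mod_cast (MeromorphicOn.AnalyticOnNhd.divisor_nonneg hf') u
    · by_cases h : u = 0
      · simp [h]
      · refine Real.log_nonneg ?_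
        have : ‖u‖ ≤ 1 := by simpa using hu
        simpa using (one_le_inv₀ (norm_pos_iff.mpr h)).2 this
  · rw [Function.locallyFinsuppWithin.apply_eq_zero_of_notMem _ hu]
    simp

/-- The majorant `g` is not compared with `log |f|` at the zeros of `f`, where `Real.log 0 = 0` is a
junk value. -/
theorem log_norm_le_circleAverage_of_le {f : ℂ → ℂ} (hf : AnalyticOnNhd ℂ f (closedBall 0 1))
    (h0 : f 0 ≠ 0) {g : ℂ → ℝ} (hg : Continuous g)
    (hfg : ∀ z, ‖z‖ = 1 → f z ≠ 0 → Real.log ‖f z‖ ≤ g z) :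
    Real.log ‖f 0‖ ≤ Real.circleAverage g 0 1 := by
  classical
  refine (log_norm_le_circleAverage hf h0).trans ?_
  -- `k` is `log ‖f‖` away from the zeros of `f`, which are isolated, and lies below `g` on the
  -- whole unit circle
  set k : ℂ → ℝ := fun z => if f z = 0 then g z else Real.log ‖f z‖ with hk
  have hne : ∀ᶠ z in codiscreteWithin (closedBall (0 : ℂ) 1), f z ≠ 0 := by
    have := hf.preimage_zero_mem_codiscreteWithin (x := 0) h0 (by simp)
      ((convex_closedBall (0 : ℂ) 1).isConnected ⟨0, by simp⟩)
    exact this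
  have hcong : (fun z => Real.log ‖f z‖) =ᶠ[codiscreteWithin (sphere (0 : ℂ) |1|)] k := by
    have hsub : sphere (0 : ℂ) |1| ⊆ closedBall (0 : ℂ) 1 := by
      simpa using sphere_subset_closedBall
    filter_upwards [codiscreteWithin_mono hsub hne] with z hz
    simp [hk, hz]
  have hi : CircleIntegrable (fun z => Real.log ‖f z‖) 0 1 := by
    apply MeromorphicOn.circleIntegrable_log_norm
    exact (hf.mono (by simpa using sphere_subset_closedBall)).meromorphicOn
  rw [Real.circleAverage_congr_codiscreteWithin hcong one_ne_zero]
  refine Real.circleAverage_mono (hi.congr_codiscreteWithin hcong)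
    hg.continuousOn.circleIntegrable' ?_
  intro z hz
  by_cases h : f z = 0
  · simp [hk, h]
  · simp only [hk, h, if_false]
    exact hfg z (by simpa using hz) h

variable {E : Type*} [NormedAddCommGroup E] [NormedSpace ℂ E]

theorem isPSHOn_log_norm {f : E → ℂ} {U : Set E} (hf : AnalyticOnNhd ℂ f U) :
    IsPSHOn (fun z => ENNReal.log ‖f z‖ₑ) U := by
  refine ⟨?_, fun z _ => by simp, fun a b hab g hg hfg => ?_⟩
  · exact (ENNReal.continuous_log.comp_continuousOn hf.continuousOn.enorm).upperSemicontinuousOn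
  · have key : ∀ z : E, f z ≠ 0 → ENNReal.log ‖f z‖ₑ = ((Real.log ‖f z‖ : ℝ) : EReal) := by
      intro z hz
      rw [← ofReal_norm, ENNReal.log_ofReal_of_pos (norm_pos_iff.2 hz)]
    by_cases h0 : f a = 0
    · simp [h0]
    · beta_reduce
      rw [key a h0, EReal.coe_le_coe_iff]
      have han : AnalyticOnNhd ℂ (fun ζ : ℂ => f (a + ζ • b)) (closedBall 0 1) := by
        intro ζ hζ
        exact AnalyticAt.fun_comp_of_eq (f := fun ζ : ℂ => a + ζ • b)
          (hf _ (hab ζ (by simpa using hζ))) (by fun_prop) rfl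
      have := log_norm_le_circleAverage_of_le han (by simpa using h0) hg (fun z hz hne => by
        have := hfg z hz
        beta_reduce at this
        rwa [key _ hne, EReal.coe_le_coe_iff] at this)
      simpa using this

/-! ### Jets and the Schwarz lemma -/

/-- Up to a factor `l!`, the coefficient at the monomial `α` of the homogeneous part of degree `l`
in the Taylor expansion of `f` at `x`, in the coordinates given by `b`. The sum over all index
sequences of type `α` replaces an appeal to the symmetry of the iterated derivative. -/
noncomputable def jetCoeff {m : ℕ} (b : Fin m → E) (x : E) (l : ℕ) (α : Fin m → ℕ)
    (f : E → ℂ) : ℂ :=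
  ∑ σ : Fin l → Fin m with (fun j => (Finset.univ.filter fun i => σ i = j).card) = α,
    iteratedFDeriv ℂ l f x (fun i => b (σ i))

theorem jetCoeff_add {m : ℕ} (b : Fin m → E) (x : E) (l : ℕ) (α : Fin m → ℕ) {f g : E → ℂ}
    (hf : AnalyticAt ℂ f x) (hg : AnalyticAt ℂ g x) :
    jetCoeff b x l α (f + g) = jetCoeff b x l α f + jetCoeff b x l α g := by
  simp [jetCoeff, iteratedFDeriv_add_apply hf.contDiffAt hg.contDiffAt, Finset.sum_add_distrib]

theorem jetCoeff_smul {m : ℕ} (b : Fin m → E) (x : E) (l : ℕ) (α : Fin m → ℕ) (c : ℂ) {f : E → ℂ}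
    (hf : AnalyticAt ℂ f x) :
    jetCoeff b x l α (c • f) = c • jetCoeff b x l α f := by
  simp [jetCoeff, iteratedFDeriv_const_smul_apply hf.contDiffAt, Finset.mul_sum]

/-- The iterated derivative on the diagonal is a homogeneous polynomial with the coefficients
`jetCoeff`. -/
theorem iteratedFDeriv_diag_eq_zero {m : ℕ} (b : Module.Basis (Fin m) ℂ E) (x : E) (l : ℕ)
    (f : E → ℂ)
    (h : ∀ α : Fin m → ℕ, (∀ j, α j ≤ l) → jetCoeff b x l α f = 0) (y : E) :
    iteratedFDeriv ℂ l f x (fun _ => y) = 0 := by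
  classical
  set c : (Fin l → Fin m) → Fin m → ℕ :=
    fun σ j => (Finset.univ.filter fun i => σ i = j).card with hc
  have hcle : ∀ σ j, c σ j ≤ l := fun σ j => (Finset.card_le_univ _).trans (by simp)
  have h1 : iteratedFDeriv ℂ l f x (fun _ => y) =
      ∑ σ : Fin l → Fin m, (∏ j, b.repr y j ^ c σ j) *
        iteratedFDeriv ℂ l f x (fun i => b (σ i)) := by
    conv_lhs => rw [← b.sum_repr y]
    rw [ContinuousMultilinearMap.map_sum]
    refine Finset.sum_congr rfl fun σ _ => ?_
    rw [ContinuousMultilinearMap.map_smul_univ, smul_eq_mul]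
    congr 1
    rw [← Finset.prod_fiberwise (s := Finset.univ) (g := σ)]
    refine Finset.prod_congr rfl fun j _ => ?_
    rw [Finset.prod_congr rfl (g := fun _ => b.repr y j)
      (fun i hi => by rw [(Finset.mem_filter.1 hi).2])]
    simp [hc]
  rw [h1, ← Finset.sum_fiberwise_of_maps_to (t := Finset.univ.image c) (g := c) (by simp)]
  refine Finset.sum_eq_zero fun α hα => ?_
  obtain ⟨σ₀, -, rfl⟩ := Finset.mem_image.1 hα
  have h2 := h (c σ₀) (hcle σ₀)
  rw [jetCoeff] at h2
  rw [Finset.sum_congr rfl (g := fun σ => (∏ j, b.repr y j ^ c σ₀ j) *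
        iteratedFDeriv ℂ l f x (fun i => b (σ i)))
      (fun σ hσ => by rw [(Finset.mem_filter.1 hσ).2]), ← Finset.mul_sum, h2, mul_zero]

theorem isLittleO_of_jetCoeff_eq_zero {m : ℕ} (b : Module.Basis (Fin m) ℂ E) {x : E} {k : ℕ}
    {f : E → ℂ} (hf : AnalyticAt ℂ f x)
    (h : ∀ l ≤ k, ∀ α : Fin m → ℕ, (∀ j, α j ≤ l) → jetCoeff b x l α f = 0) :
    f =o[𝓝 x] fun w => ‖w - x‖ ^ k := by
  obtain ⟨p, r, hp⟩ := hf
  have hz : ∀ l ≤ k, ∀ y, p l (fun _ => y) = 0 := by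
    intro l hl y
    have := hp.factorial_smul y l
    rw [iteratedFDeriv_diag_eq_zero b x l f (h l hl) y] at this
    simpa [Nat.factorial_ne_zero] using this
  have hO := hp.hasFPowerSeriesAt.isBigO_sub_partialSum_pow (k + 1)
  have hps : ∀ y, p.partialSum (k + 1) y = 0 := by
    intro y
    exact Finset.sum_eq_zero fun l hl => hz l (by simpa [Nat.lt_succ_iff] using hl) y
  simp only [hps, sub_zero] at hO
  have hO' : f =O[𝓝 x] fun w => ‖w - x‖ ^ (k + 1) := by
    have ht : Tendsto (fun w => w - x) (𝓝 x) (𝓝 0) := by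
      exact tendsto_sub_nhds_zero_iff.2 tendsto_id
    simpa [Function.comp_def] using hO.comp_tendsto ht
  refine hO'.trans_isLittleO ?_
  have : (fun w => ‖w - x‖ ^ (k + 1)) = fun w => ‖w - x‖ ^ k * ‖w - x‖ := by
    ext w; rw [pow_succ]
  rw [this]
  have h1 : (fun w : E => ‖w - x‖) =o[𝓝 x] fun _ => (1 : ℝ) := by
    rw [Asymptotics.isLittleO_one_iff]
    exact tendsto_iff_norm_sub_tendsto_zero.1 tendsto_id
  simpa using (Asymptotics.isBigO_refl (fun w : E => ‖w - x‖ ^ k) (𝓝 x)).mul_isLittleO h1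

/-- The Schwarz lemma for a function that vanishes to order `k + 1` at the centre of a ball. -/
theorem norm_le_of_jetCoeff_eq_zero {m : ℕ} (b : Module.Basis (Fin m) ℂ E) {x : E} {k : ℕ}
    {f : E → ℂ} {R M : ℝ} (hR : 0 < R) (hf : AnalyticOnNhd ℂ f (ball x R))
    (hM : ∀ z ∈ ball x R, ‖f z‖ ≤ M)
    (h : ∀ l ≤ k, ∀ α : Fin m → ℕ, (∀ j, α j ≤ l) → jetCoeff b x l α f = 0)
    {z : E} (hz : z ∈ ball x R) : ‖f z‖ ≤ M * (dist z x / R) ^ (k + 1) := by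
  have hx := mem_ball_self (x := x) hR
  have hf0 : f x = 0 := by
    simpa using iteratedFDeriv_diag_eq_zero b x 0 f (h 0 (Nat.zero_le _)) 0
  have := Complex.dist_le_mul_div_pow_of_mapsTo_ball_of_isLittleO (n := k) hf.differentiableOn
    (R₂ := M) (fun w hw => by simpa [hf0] using hM w hw)
    (by simpa [hf0] using isLittleO_of_jetCoeff_eq_zero b (hf x hx) h) hz
  simpa [hf0] using this

/-! ### Sections in local trivializations -/

section Coord

variable {E : Type*} [NormedAddCommGroup E] [NormedSpace ℂ E]
variable {X ι : Type*} [TopologicalSpace X] [ChartedSpace E X]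
variable {L : VectorBundleCore ℂ X ℂ ι} {n : ℕ}

instance power_isContMDiff [L.IsContMDiff 𝓘(ℂ, E) ω] : (power L n).IsContMDiff 𝓘(ℂ, E) ω where
  contMDiffOn_coordChange i j := by
    have h : ContMDiffOn 𝓘(ℂ, E) 𝓘(ℂ, ℂ) ω (fun x => transition L j i x)
        (L.baseSet i ∩ L.baseSet j) :=
      (L.contMDiffOn_coordChange 𝓘(ℂ, E) i j).clm_apply contMDiffOn_const
    exact (h.pow n).smul contMDiffOn_const

/-- The value `s x` of a section of `Lⁿ`, as a complex number. The fibre is `ℂ` by definition, but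
only after unfolding, and algebra is carried out in `ℂ`. -/
noncomputable def val (s : H0 E L n) (x : X) : ℂ := s x

theorem val_add (s t : H0 E L n) (x : X) : val (s + t) x = val s x + val t x := rfl

theorem val_smul (c : ℂ) (s : H0 E L n) (x : X) : val (c • s) x = c * val s x := rfl

theorem val_zero (x : X) : val (0 : H0 E L n) x = 0 := rfl

theorem val_sum {κ : Type*} (t : Finset κ) (f : κ → H0 E L n) (x : X) :
    val (∑ k ∈ t, f k) x = ∑ k ∈ t, val (f k) x :=
  map_sum (⟨⟨fun s => val s x, val_zero x⟩, fun s t => val_add s t x⟩ : H0 E L n →+ ℂ) f t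

theorem ext_val {s t : H0 E L n} (h : ∀ x, val s x = val t x) : s = t := ContMDiffSection.ext h

/-- The coordinate of a section of `Lⁿ` in the trivialization `i`. -/
noncomputable def coord (s : H0 E L n) (i : ι) (x : X) : ℂ :=
  transition L i (L.indexAt x) x ^ n * val s x

theorem coord_add (s t : H0 E L n) (i : ι) : coord (s + t) i = coord s i + coord t i := by
  ext x
  simp [coord, val_add, mul_add]

theorem coord_smul (c : ℂ) (s : H0 E L n) (i : ι) : coord (c • s) i = c • coord s i := by
  ext x
  simp only [coord, val_smul, Pi.smul_apply, smul_eq_mul]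
  ring

theorem contMDiffOn_coord [L.IsContMDiff 𝓘(ℂ, E) ω] (s : H0 E L n) (i : ι) :
    ContMDiffOn 𝓘(ℂ, E) 𝓘(ℂ, ℂ) ω (coord s i) (L.baseSet i) := by
  have : MemTrivializationAtlas ((power L n).localTriv i) := ⟨i, rfl⟩
  have h := ((power L n).localTriv i).contMDiffOn_section_baseSet_iff (IB := 𝓘(ℂ, E)) (n := ω)
    (s := s)
  refine (h.1 s.contMDiff.contMDiffOn).congr fun x _ => ?_
  change transition L i (L.indexAt x) x ^ n * val s x =
    (power L n).coordChange (L.indexAt x) i x (val s x)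
  simp [power]

theorem analyticOnNhd_coord [IsManifold 𝓘(ℂ, E) ω X]
    [L.IsContMDiff 𝓘(ℂ, E) ω] (s : H0 E L n) (i : ι)
    {e : OpenPartialHomeomorph X E} (he : e ∈ atlas E X) :
    AnalyticOnNhd ℂ (coord s i ∘ e.symm) (e.target ∩ e.symm ⁻¹' L.baseSet i) := by
  have ho : IsOpen (e.target ∩ e.symm ⁻¹' L.baseSet i) :=
    e.isOpen_inter_preimage_symm (L.isOpen_baseSet i)
  have h1 : ContMDiffOn 𝓘(ℂ, E) 𝓘(ℂ, E) ω e.symm e.target :=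
    contMDiffOn_symm_of_mem_maximalAtlas (IsManifold.subset_maximalAtlas he)
  have h2 := (contMDiffOn_coord s i).comp (h1.mono inter_subset_left) (fun z hz => hz.2)
  exact ho.analyticOn_iff_analyticOnNhd.1 (ContDiffOn.analyticOn (contMDiffOn_iff_contDiffOn.1 h2))

theorem norm_transition_pos (L : VectorBundleCore ℂ X ℂ ι) {i j : ι} {x : X}
    (hx : x ∈ L.baseSet i ∩ L.baseSet j) : 0 < ‖transition L i j x‖ := by
  rw [norm_pos_iff]
  intro h
  have := L.coordChange_comp i j i x ⟨hx, hx.1⟩ 1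
  simp [coordChange_apply, L.coordChange_self i x hx.1, h] at this

/-- The Hermitian form can be computed in any trivialization: the factors `|g_{ij}|^{2n}` from the
coordinates and from the weights cancel. -/
theorem form_eq (h : SmoothMetric E L) (s t : H0 E L n) {i : ι} {x : X} (hx : x ∈ L.baseSet i) :
    h.form n x (val s x) (val t x) = coord s i x * (starRingEnd ℂ) (coord t i x) *
      (Real.exp (-(2 * n * h.weight i x)) : ℝ) := by
  have hx' : x ∈ L.baseSet i ∩ L.baseSet (L.indexAt x) := ⟨hx, L.mem_baseSet_at x⟩
  have hpos := norm_transition_pos L hx'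
  rw [h.weight_eq i (L.indexAt x) x hx']
  set g := transition L i (L.indexAt x) x with hg
  have h1 : Real.exp (-(2 * n * (h.weight (L.indexAt x) x + Real.log ‖g‖))) =
      Real.exp (-(2 * n * h.weight (L.indexAt x) x)) * ((‖g‖ ^ 2) ^ n)⁻¹ := by
    rw [mul_add, neg_add, Real.exp_add, Real.exp_neg (2 * n * Real.log ‖g‖), ← pow_mul,
      show 2 * (n : ℝ) * Real.log ‖g‖ = ((2 * n : ℕ) : ℝ) * Real.log ‖g‖ by push_cast; ring,
      Real.exp_nat_mul, Real.exp_log hpos]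
  have h2 : g ^ n * (starRingEnd ℂ) (g ^ n) = (((‖g‖ ^ 2) ^ n : ℝ) : ℂ) := by
    rw [map_pow, ← mul_pow, Complex.mul_conj, Complex.normSq_eq_norm_sq]
    push_cast; rfl
  have h3 : (((‖g‖ ^ 2) ^ n : ℝ) : ℂ) ≠ 0 := by
    exact_mod_cast (by positivity : ((‖g‖ ^ 2) ^ n : ℝ) ≠ 0)
  rw [h1, SmoothMetric.form, coord, coord, map_mul]
  rw [← hg]
  push_cast at h2 h3 ⊢
  calc _ = val s x * (starRingEnd ℂ) (val t x) *
        Complex.exp (-(2 * n * (h.weight (L.indexAt x) x : ℂ))) *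
          (((‖g‖ : ℂ) ^ 2) ^ n * (((‖g‖ : ℂ) ^ 2) ^ n)⁻¹) := by
        rw [mul_inv_cancel₀ h3, mul_one]
    _ = _ := by rw [← h2]; ring

theorem nrm_nonneg (h : SmoothMetric E L) (x : X) (v : ℂ) : 0 ≤ h.nrm n x v := by
  unfold SmoothMetric.nrm; positivity

theorem nrm_eq (h : SmoothMetric E L) (s : H0 E L n) {i : ι} {x : X} (hx : x ∈ L.baseSet i) :
    h.nrm n x (val s x) = ‖coord s i x‖ * Real.exp (-(n * h.weight i x)) := by
  have h1 : h.nrm n x (val s x) ^ 2 = (‖coord s i x‖ * Real.exp (-(n * h.weight i x))) ^ 2 := by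
    have := form_eq h s s hx
    rw [h.form_self, Complex.mul_conj, Complex.normSq_eq_norm_sq] at this
    have h2 : h.nrm n x (val s x) ^ 2 = ‖coord s i x‖ ^ 2 * Real.exp (-(2 * n * h.weight i x)) := by
      exact_mod_cast this
    rw [h2, mul_pow, ← Real.exp_nat_mul]
    push_cast
    ring_nf
  exact (pow_left_inj₀ (nrm_nonneg h x _) (by positivity) two_ne_zero).1 h1

theorem continuous_form [L.IsContMDiff 𝓘(ℂ, E) ω] (h : SmoothMetric E L) (s t : H0 E L n) :
    Continuous fun x => h.form n x (val s x) (val t x) := by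
  rw [continuous_iff_continuousAt]
  intro x
  set i := L.indexAt x
  have hU : L.baseSet i ∈ 𝓝 x := (L.isOpen_baseSet i).mem_nhds (L.mem_baseSet_at x)
  have hs := (contMDiffOn_coord s i).continuousOn.continuousAt hU
  have ht := (contMDiffOn_coord t i).continuousOn.continuousAt hU
  have hw := (h.contMDiffOn_weight i).continuousOn.continuousAt hU
  have : ContinuousAt (fun x => coord s i x * (starRingEnd ℂ) (coord t i x) *
      (Real.exp (-(2 * n * h.weight i x)) : ℝ)) x := by
    refine (hs.mul (Complex.continuous_conj.continuousAt.comp ht)).mul ?_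
    exact Complex.continuous_ofReal.continuousAt.comp
      (Real.continuous_exp.continuousAt.comp (continuousAt_const.mul hw).neg)
  refine this.congr ?_
  filter_upwards [hU] with y hy using (form_eq h s t hy).symm

theorem nrm_eq_sqrt (h : SmoothMetric E L) (x : X) (v : ℂ) :
    h.nrm n x v = Real.sqrt (h.form n x v v).re := by
  rw [h.form_self, Complex.ofReal_re, Real.sqrt_sq (nrm_nonneg h x v)]

theorem continuous_nrm [L.IsContMDiff 𝓘(ℂ, E) ω] (h : SmoothMetric E L) (s : H0 E L n) :
    Continuous fun x => h.nrm n x (val s x) := by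
  simp only [nrm_eq_sqrt]
  exact (Complex.continuous_re.comp (continuous_form h s s)).sqrt

theorem isManifold_real [IsManifold 𝓘(ℂ, E) ω X] : IsManifold 𝓘(ℝ, E) ∞ X := by
  refine isManifold_of_contDiffOn _ _ _ fun e e' he he' => ?_
  have h1 := (contDiffGroupoid ω 𝓘(ℂ, E)).compatible he he'
  rw [contDiffGroupoid, mem_groupoid_of_pregroupoid] at h1
  have h2 := h1.1
  simp only [contDiffPregroupoid, modelWithCornersSelf_coe,
    modelWithCornersSelf_coe_symm, Function.id_comp, Function.comp_id, preimage_id, range_id,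
    inter_univ] at h2 ⊢
  exact (h2.restrict_scalars ℝ).of_le le_top

theorem contDiffOn_weight [IsManifold 𝓘(ℂ, E) ω X] (h : SmoothMetric E L) (i : ι)
    {e : OpenPartialHomeomorph X E} (he : e ∈ atlas E X) :
    ContDiffOn ℝ ∞ (h.weight i ∘ e.symm) (e.target ∩ e.symm ⁻¹' L.baseSet i) := by
  have : IsManifold 𝓘(ℝ, E) ∞ X := isManifold_real
  have h1 : ContMDiffOn 𝓘(ℝ, E) 𝓘(ℝ, E) ∞ e.symm e.target :=
    contMDiffOn_symm_of_mem_maximalAtlas (IsManifold.subset_maximalAtlas he)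
  exact ((h.contMDiffOn_weight i).comp (h1.mono inter_subset_left) (fun z hz => hz.2)).contDiffOn

/-- `log ‖s‖` is quasi-plurisubharmonic: locally it is the plurisubharmonic `log |s_i|` plus the
smooth `-n φ_i`. -/
theorem isQPSH_log_nrm [IsManifold 𝓘(ℂ, E) ω X] [L.IsContMDiff 𝓘(ℂ, E) ω]
    (h : SmoothMetric E L) (s : H0 E L n) :
    IsQPSH E (fun x => ENNReal.log (ENNReal.ofReal (h.nrm n x (val s x)))) := by
  refine ⟨?_, fun x => by
    rw [Ne, ENNReal.log_eq_top_iff]; exact ENNReal.ofReal_ne_top, fun x => ?_⟩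
  · exact (ENNReal.continuous_log.comp
      (ENNReal.continuous_ofReal.comp (continuous_nrm h s))).upperSemicontinuous
  set i := L.indexAt x
  set e := chartAt E x
  have he : e ∈ atlas E X := chart_mem_atlas E x
  refine ⟨e, he, e.target ∩ e.symm ⁻¹' L.baseSet i, mem_chart_source E x,
    e.isOpen_inter_preimage_symm (L.isOpen_baseSet i),
    ⟨mem_chart_target E x, by
      rw [mem_preimage, e.left_inv (mem_chart_source E x)]
      exact L.mem_baseSet_at x⟩, inter_subset_left,
    fun z => ENNReal.log ‖coord s i (e.symm z)‖ₑ, fun z => -(n * h.weight i (e.symm z)),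
    isPSHOn_log_norm (analyticOnNhd_coord s i he),
    (contDiffOn_const.mul (contDiffOn_weight h i he)).neg, fun z hz => ?_⟩
  beta_reduce
  rw [nrm_eq h s hz.2, ENNReal.ofReal_mul (norm_nonneg _), ENNReal.log_mul_add,
    ENNReal.log_ofReal_of_pos (Real.exp_pos _), Real.log_exp, ofReal_norm]

theorem nrm_eq_zero (h : SmoothMetric E L) {x : X} {v : ℂ} : h.nrm n x v = 0 ↔ v = 0 := by
  simp [SmoothMetric.nrm]

/-- A non-pluripolar set is a set of uniqueness for sections. -/
theorem eq_zero_of_eqOn_zero [IsManifold 𝓘(ℂ, E) ω X] [L.IsContMDiff 𝓘(ℂ, E) ω]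
    (h : SmoothMetric E L) {K : Set X} (hK : ¬ IsPluripolar E K) (s : H0 E L n)
    (hs : ∀ x ∈ K, h.nrm n x (val s x) = 0) : s = 0 := by
  by_contra hne
  obtain ⟨x, hx⟩ : ∃ x, val s x ≠ 0 := by
    by_contra! hcon
    exact hne (ext_val hcon)
  refine hK ⟨_, isQPSH_log_nrm h s, ⟨x, ?_⟩, fun y hy => by simp [hs y hy]⟩
  have : 0 < h.nrm n x (val s x) :=
    lt_of_le_of_ne (nrm_nonneg h x _) (Ne.symm (mt (nrm_eq_zero h).1 hx))
  simpa using this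

end Coord

/-! ### Siegel's bound for the dimension of the space of sections -/

section Siegel

variable {E : Type*} [NormedAddCommGroup E] [NormedSpace ℂ E]
variable {X ι : Type*} [TopologicalSpace X] [ChartedSpace E X]
variable {L : VectorBundleCore ℂ X ℂ ι} {n : ℕ}

/-- The coordinate of a section near `p`, read in the preferred trivialization and the preferred
chart at `p`. -/
noncomputable def localRep (s : H0 E L n) (p : X) : E → ℂ :=
  coord s (L.indexAt p) ∘ (chartAt E p).symm

theorem analyticAt_localRep [IsManifold 𝓘(ℂ, E) ω X] [L.IsContMDiff 𝓘(ℂ, E) ω]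
    (s : H0 E L n) (p : X) : AnalyticAt ℂ (localRep s p) (chartAt E p p) := by
  refine analyticOnNhd_coord s (L.indexAt p) (chart_mem_atlas E p) _ ⟨mem_chart_target E p, ?_⟩
  rw [mem_preimage, (chartAt E p).left_inv (mem_chart_source E p)]
  exact L.mem_baseSet_at p

theorem exists_ball_weight_sub_le (h : SmoothMetric E L) (p : X) :
    ∃ R > 0, ball (chartAt E p p) R ⊆
        (chartAt E p).target ∩ (chartAt E p).symm ⁻¹' L.baseSet (L.indexAt p) ∧
      ∀ z ∈ ball (chartAt E p p) R,
        |h.weight (L.indexAt p) ((chartAt E p).symm z) - h.weight (L.indexAt p) p| ≤ 1 / 2 := by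
  set e := chartAt E p
  set i := L.indexAt p
  have hp : e.symm (e p) = p := e.left_inv (mem_chart_source E p)
  have hU : e.target ∩ e.symm ⁻¹' L.baseSet i ∈ 𝓝 (e p) := by
    refine (e.isOpen_inter_preimage_symm (L.isOpen_baseSet i)).mem_nhds
      ⟨mem_chart_target E p, ?_⟩
    rw [mem_preimage, hp]
    exact L.mem_baseSet_at p
  have hc : ContinuousAt (fun z => h.weight i (e.symm z)) (e p) := by
    have h1 : ContinuousAt (h.weight i) (e.symm (e p)) := by
      rw [hp]
      exact (h.contMDiffOn_weight i).continuousOn.continuousAt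
        ((L.isOpen_baseSet i).mem_nhds (L.mem_baseSet_at p))
    exact h1.comp (e.continuousAt_symm (mem_chart_target E p))
  have h2 := hc (ball_mem_nhds _ (by norm_num : (0 : ℝ) < 1 / 2))
  rw [mem_map] at h2
  obtain ⟨R, hR, hsub⟩ := Metric.mem_nhds_iff.1 (inter_mem hU h2)
  refine ⟨R, hR, fun z hz => (hsub hz).1, fun z hz => ?_⟩
  have h3 : h.weight i (e.symm z) ∈ ball (h.weight i (e.symm (e p))) (1 / 2) := (hsub hz).2
  rw [hp, mem_ball, Real.dist_eq] at h3
  exact h3.le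

/-- Sections of `Lⁿ` are determined by their `n`-jets at finitely many points, chosen independently
of `n`. -/
theorem exists_finset_jets_injective [IsManifold 𝓘(ℂ, E) ω X] [CompactSpace X]
    [L.IsContMDiff 𝓘(ℂ, E) ω] (h : SmoothMetric E L) :
    ∃ t : Finset X, ∀ {m : ℕ} (b : Module.Basis (Fin m) ℂ E) (n : ℕ) (s : H0 E L n),
      (∀ p ∈ t, ∀ l ≤ n, ∀ α : Fin m → ℕ, (∀ j, α j ≤ l) →
        jetCoeff b (chartAt E p p) l α (localRep s p) = 0) → s = 0 := by
  choose R hR hsub hosc using exists_ball_weight_sub_le (E := E) h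
  -- radii shrink by the factor `e`, so that the Schwarz lemma gains `e^{-(n + 1)}`, which beats the
  -- loss of at most `e^n` from the variation of the weight
  set W : X → Set X := fun p =>
    (chartAt E p).source ∩ chartAt E p ⁻¹' ball (chartAt E p p) (R p / Real.exp 1) with hW
  have hWo : ∀ p, W p ∈ 𝓝 p := fun p =>
    ((chartAt E p).isOpen_inter_preimage isOpen_ball).mem_nhds
      ⟨mem_chart_source E p, mem_ball_self (div_pos (hR p) (Real.exp_pos 1))⟩
  obtain ⟨t, -, ht⟩ := isCompact_univ.elim_nhds_subcover W fun p _ => hWo p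
  refine ⟨t, fun {m} b n s hs => ?_⟩
  rcases isEmpty_or_nonempty X with hX | hX
  · exact ext_val fun x => hX.elim x
  obtain ⟨x, -, hx⟩ := isCompact_univ.exists_isMaxOn univ_nonempty
    (continuous_nrm h s).continuousOn
  have hmax : ∀ y, h.nrm n y (val s y) ≤ h.nrm n x (val s x) := fun y => hx (mem_univ y)
  set M := h.nrm n x (val s x) with hM
  have hM0 : 0 ≤ M := nrm_nonneg h x _
  obtain ⟨p, hp, hxp⟩ := mem_iUnion₂.1 (ht (mem_univ x))
  set e := chartAt E p
  set i := L.indexAt p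
  have hxs : e.symm (e x) = x := e.left_inv hxp.1
  have hle : R p / Real.exp 1 ≤ R p :=
    div_le_self (hR p).le (Real.one_le_exp zero_le_one)
  have hxR : e x ∈ ball (e p) (R p) := ball_subset_ball hle hxp.2
  have hxi : x ∈ L.baseSet i := by
    have h1 : e.symm (e x) ∈ L.baseSet i := (hsub p hxR).2
    rwa [hxs] at h1
  have hbound : ∀ z ∈ ball (e p) (R p),
      ‖localRep s p z‖ ≤ M * Real.exp (n * h.weight i p + n / 2) := by
    intro z hz
    have h1 := nrm_eq h s (hsub p hz).2
    have h2 : ‖localRep s p z‖ =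
        h.nrm n (e.symm z) (val s (e.symm z)) * Real.exp (n * h.weight i (e.symm z)) := by
      rw [h1, mul_assoc, ← Real.exp_add, neg_add_cancel, Real.exp_zero, mul_one]
      rfl
    rw [h2]
    refine mul_le_mul (hmax _) (Real.exp_le_exp.2 ?_) (Real.exp_pos _).le hM0
    have h3 := (abs_le.1 (hosc p z hz)).2
    have := mul_le_mul_of_nonneg_left h3 (Nat.cast_nonneg (α := ℝ) n)
    linarith
  have key := norm_le_of_jetCoeff_eq_zero b (hR p)
    ((analyticOnNhd_coord s i (chart_mem_atlas E p)).mono (hsub p)) hbound (hs p hp) hxR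
  have hratio : dist (e x) (e p) / R p ≤ Real.exp (-1) := by
    rw [div_le_iff₀ (hR p), Real.exp_neg, ← div_eq_inv_mul]
    exact (mem_ball.1 hxp.2).le
  have hfin : M ≤ M * Real.exp (-1) := by
    calc M = ‖localRep s p (e x)‖ * Real.exp (-(n * h.weight i x)) := by
          rw [hM, nrm_eq h s (i := i) hxi]
          simp [localRep, e, i, hxs]
      _ ≤ (M * Real.exp (n * h.weight i p + n / 2) * Real.exp (-1) ^ (n + 1)) *
            Real.exp (-(n * h.weight i x)) := by
          refine mul_le_mul_of_nonneg_right (key.trans ?_) (Real.exp_pos _).le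
          refine mul_le_mul_of_nonneg_left ?_ (by positivity)
          exact pow_le_pow_left₀ (div_nonneg dist_nonneg (hR p).le) hratio _
      _ = M * Real.exp (n * h.weight i p + n / 2 + -(n + 1) + -(n * h.weight i x)) := by
          rw [← Real.exp_nat_mul, mul_assoc, mul_assoc, ← Real.exp_add, ← Real.exp_add]
          congr 2
          push_cast
          ring
      _ ≤ M * Real.exp (-1) := by
          refine mul_le_mul_of_nonneg_left (Real.exp_le_exp.2 ?_) hM0
          have h3 := (abs_le.1 (hosc p _ hxR)).1
          rw [hxs] at h3
          have := mul_le_mul_of_nonneg_left h3 (Nat.cast_nonneg (α := ℝ) n)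
          linarith
  have hlt : Real.exp (-1) < 1 := Real.exp_lt_one_iff.2 (by norm_num)
  have hMz : M = 0 := by nlinarith
  refine ext_val fun y => ?_
  rw [val_zero]
  exact (nrm_eq_zero h).1 (le_antisymm ((hmax y).trans hMz.le) (nrm_nonneg h y _))

/-- Siegel's bound. The degree `l ≤ n` and the exponents `α j ≤ n` of a monomial are recorded
separately, which costs a factor `n + 1` but is enough for a polynomial bound. -/
theorem exists_dimH0_le [FiniteDimensional ℂ E] [IsManifold 𝓘(ℂ, E) ω X] [CompactSpace X]
    [L.IsContMDiff 𝓘(ℂ, E) ω] (h : SmoothMetric E L) :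
    ∃ N : ℕ, ∀ n, FiniteDimensional ℂ (H0 E L n) ∧
      dimH0 E L n ≤ N * (n + 1) ^ (Module.finrank ℂ E + 1) := by
  obtain ⟨t, ht⟩ := exists_finset_jets_injective h
  refine ⟨t.card, fun n => ?_⟩
  set m := Module.finrank ℂ E
  let b : Module.Basis (Fin m) ℂ E := Module.finBasis ℂ E
  let J : H0 E L n →ₗ[ℂ] (t × Fin (n + 1) × (Fin m → Fin (n + 1)) → ℂ) :=
    { toFun := fun s a => jetCoeff b (chartAt E a.1.1 a.1.1) a.2.1 (fun j => a.2.2 j)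
        (localRep s a.1.1)
      map_add' := fun s s' => by
        ext a
        rw [Pi.add_apply, ← jetCoeff_add _ _ _ _ (analyticAt_localRep s _)
          (analyticAt_localRep s' _)]
        simp only [localRep, coord_add]
        rfl
      map_smul' := fun c s => by
        ext a
        rw [Pi.smul_apply, RingHom.id_apply, ← jetCoeff_smul _ _ _ _ _ (analyticAt_localRep s _)]
        simp only [localRep, coord_smul]
        rfl }
  have hJ : Function.Injective J := by
    rw [injective_iff_map_eq_zero]
    intro s hs
    refine ht b n s fun p hp l hl α hα => ?_
    exact congrFun hs (⟨p, hp⟩, ⟨l, Nat.lt_succ_of_le hl⟩,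
      fun j => ⟨α j, Nat.lt_succ_of_le ((hα j).trans hl)⟩)
  refine ⟨FiniteDimensional.of_injective J hJ, ?_⟩
  have := LinearMap.finrank_le_finrank_of_injective hJ
  rw [Module.finrank_fintype_fun_eq_card] at this
  refine this.trans (le_of_eq ?_)
  simp [pow_succ, mul_comm]

end Siegel

/-! ### The inner product on `K`, the Bergman function and the extremal function -/

section Bergman

variable {E : Type*} [NormedAddCommGroup E] [NormedSpace ℂ E]
variable {X ι : Type*} [TopologicalSpace X] [ChartedSpace E X]
variable {L : VectorBundleCore ℂ X ℂ ι} {n : ℕ}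
variable (h : SmoothMetric E L)

section Pointwise

theorem nrm_mul (x : X) (c v : ℂ) : h.nrm n x (c * v) = ‖c‖ * h.nrm n x v := by
  simp only [SmoothMetric.nrm, norm_mul, mul_assoc]

theorem bergman_nonneg (S : Module.Basis (Fin (dimH0 E L n)) ℂ (H0 E L n)) (x : X) :
    0 ≤ bergman h n S x :=
  Finset.sum_nonneg fun _ _ => sq_nonneg _

/-- Cauchy-Schwarz for the expansion of `s` in the basis `S`. -/
theorem nrm_sq_le_sum_mul_bergman (S : Module.Basis (Fin (dimH0 E L n)) ℂ (H0 E L n))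
    (s : H0 E L n) (x : X) :
    h.nrm n x (val s x) ^ 2 ≤ (∑ j, ‖S.repr s j‖ ^ 2) * bergman h n S x := by
  have h1 : ‖val s x‖ ≤ ∑ j, ‖S.repr s j‖ * ‖val (S j) x‖ := by
    conv_lhs => rw [← S.sum_repr s, val_sum]
    refine (norm_sum_le _ _).trans (le_of_eq ?_)
    simp [val_smul]
  have h2 : h.nrm n x (val s x) ≤ ∑ j, ‖S.repr s j‖ * h.nrm n x (val (S j) x) := by
    simp only [SmoothMetric.nrm, ← mul_assoc, ← Finset.sum_mul]
    exact mul_le_mul_of_nonneg_right h1 (Real.exp_pos _).le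
  refine (pow_le_pow_left₀ (nrm_nonneg h x _) h2 2).trans ?_
  exact Finset.sum_mul_sq_le_sq_mul_sq _ _ _

theorem zero_mem_phiSet (K : Set X) (q : X → ℝ) (x : X) : 0 ∈ phiSet h K q n x := by
  have h0 : ∀ y, h.nrm n y (val (0 : H0 E L n) y) = 0 := fun y => by
    rw [val_zero, nrm_eq_zero]
  refine ⟨0, fun y _ => ?_, (h0 x).symm⟩
  have := h0 y
  change h.nrm n y (val (0 : H0 E L n) y) * _ ≤ 1
  rw [this, zero_mul]
  exact zero_le_one

theorem Phi_nonneg (K : Set X) (q : X → ℝ) (x : X) : 0 ≤ Phi h K q n x := by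
  refine Real.sSup_nonneg ?_
  rintro _ ⟨s, -, rfl⟩
  exact nrm_nonneg h x (val s x)

theorem bergman_pos (S : Module.Basis (Fin (dimH0 E L n)) ℂ (H0 E L n)) {x : X}
    {s : H0 E L n} (hs : val s x ≠ 0) : 0 < bergman h n S x := by
  refine lt_of_le_of_ne (bergman_nonneg h S x) fun h0 => hs ?_
  have h1 := nrm_sq_le_sum_mul_bergman h S s x
  rw [← h0, mul_zero] at h1
  exact (nrm_eq_zero h).1 (pow_eq_zero_iff two_ne_zero |>.1 (le_antisymm h1 (sq_nonneg _)))

end Pointwise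

section Algebra

variable [MeasurableSpace X] (μ : Measure X) {K : Set X} {q : X → ℝ}

/-- The squared norm of `s` for `innerK`. -/
noncomputable def normSqK (K : Set X) (q : X → ℝ) (s : H0 E L n) : ℝ :=
  ∫ y in K, h.nrm n y (val s y) ^ 2 * Real.exp (-(2 * n * q y)) ∂μ

theorem innerK_self (s : H0 E L n) : innerK h K q μ n s s = (normSqK h μ K q s : ℂ) := by
  rw [normSqK, ← integral_complex_ofReal]
  refine integral_congr_ae (Eventually.of_forall fun y => ?_)
  change h.form n y (val s y) (val s y) * _ = _
  rw [h.form_self]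
  push_cast
  rfl

theorem normSqK_nonneg (s : H0 E L n) : 0 ≤ normSqK h μ K q s :=
  integral_nonneg fun _ => by positivity

theorem innerK_smul_left (c : ℂ) (s u : H0 E L n) :
    innerK h K q μ n (c • s) u = c * innerK h K q μ n s u := by
  rw [innerK, innerK, ← integral_const_mul]
  refine integral_congr_ae (Eventually.of_forall fun y => ?_)
  change h.form n y (c * val s y) (val u y) * _ = c * (h.form n y (val s y) (val u y) * _)
  simp only [SmoothMetric.form]
  ring

theorem conj_innerK (s t : H0 E L n) :
    (starRingEnd ℂ) (innerK h K q μ n s t) = innerK h K q μ n t s := by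
  rw [innerK, innerK, ← integral_conj]
  refine integral_congr_ae (Eventually.of_forall fun y => ?_)
  change (starRingEnd ℂ) (h.form n y (val s y) (val t y) * _) =
    h.form n y (val t y) (val s y) * _
  simp only [SmoothMetric.form, map_mul, Complex.conj_conj, Complex.conj_ofReal]
  ring

end Algebra

section Integral

variable [MeasurableSpace X] [BorelSpace X] [T2Space X] [L.IsContMDiff 𝓘(ℂ, E) ω]
variable {K : Set X} (hK : IsCompact K) {q : X → ℝ} (hq : ContinuousOn q K)
  (μ : Measure X) [IsFiniteMeasure μ]

include hK hq in
theorem integrable_form (s t : H0 E L n) :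
    Integrable (fun y => h.form n y (val s y) (val t y) * (Real.exp (-(2 * n * q y)) : ℝ))
      (μ.restrict K) := by
  refine ContinuousOn.integrableOn_compact hK ?_
  refine (continuous_form h s t).continuousOn.mul ?_
  exact Complex.continuous_ofReal.comp_continuousOn
    (Real.continuous_exp.comp_continuousOn (continuousOn_const.mul hq).neg)

include hK hq in
theorem integrable_nrm_sq (s : H0 E L n) :
    Integrable (fun y => h.nrm n y (val s y) ^ 2 * Real.exp (-(2 * n * q y)))
      (μ.restrict K) := by
  refine ContinuousOn.integrableOn_compact hK ?_
  exact ((continuous_nrm h s).pow 2).continuousOn.mul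
    (Real.continuous_exp.comp_continuousOn (continuousOn_const.mul hq).neg)

include hK hq in
theorem normSqK_le_of_le_one (s : H0 E L n)
    (hs : ∀ y ∈ K, h.nrm n y (val s y) * Real.exp (-(n * q y)) ≤ 1) :
    normSqK h μ K q s ≤ μ.real K := by
  have h1 : normSqK h μ K q s ≤ ∫ _ in K, (1 : ℝ) ∂μ := by
    refine setIntegral_mono_on (integrable_nrm_sq h hK hq μ s) (integrable_const _)
      hK.measurableSet fun y hy => ?_
    have h2 : h.nrm n y (val s y) ^ 2 * Real.exp (-(2 * n * q y)) =
        (h.nrm n y (val s y) * Real.exp (-(n * q y))) ^ 2 := by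
      rw [mul_pow, ← Real.exp_nat_mul]
      push_cast
      ring_nf
    rw [h2]
    exact pow_le_one₀ (mul_nonneg (nrm_nonneg h y _) (Real.exp_pos _).le) (hs y hy)
  simpa using h1

include hK hq in
theorem innerK_add_left (s t u : H0 E L n) :
    innerK h K q μ n (s + t) u = innerK h K q μ n s u + innerK h K q μ n t u := by
  refine Eq.trans ?_ (integral_add (integrable_form h hK hq μ s u) (integrable_form h hK hq μ t u))
  refine integral_congr_ae (Eventually.of_forall fun y => ?_)
  change h.form n y (val s y + val t y) (val u y) * _ = _
  rw [SmoothMetric.form, add_mul, add_mul, add_mul]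
  rfl

/-- `innerK` as an inner product. Mathlib's inner products are linear in the second argument,
hence the swap. -/
@[reducible] noncomputable def innerKCore
    (hdef : ∀ s : H0 E L n, normSqK h μ K q s = 0 → s = 0) :
    InnerProductSpace.Core ℂ (H0 E L n) where
  inner s t := innerK h K q μ n t s
  conj_inner_symm s t := conj_innerK h μ s t
  re_inner_nonneg s := by
    rw [innerK_self]
    exact normSqK_nonneg h μ s
  add_left s t u := by
    rw [← conj_innerK, innerK_add_left h hK hq, map_add, conj_innerK, conj_innerK]
  smul_left s t c := by
    rw [← conj_innerK, innerK_smul_left, map_mul, conj_innerK]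
  definite s hs := hdef s (by
    rw [innerK_self] at hs
    exact_mod_cast hs)

include hK hq in
theorem exists_isOrthonormalBasis [FiniteDimensional ℂ (H0 E L n)]
    (hdef : ∀ s : H0 E L n, normSqK h μ K q s = 0 → s = 0) :
    ∃ S, IsOrthonormalBasis h K q μ n S := by
  let core := innerKCore h hK hq μ hdef
  let _ : NormedAddCommGroup (H0 E L n) := core.toNormedAddCommGroup
  let _ : InnerProductSpace ℂ (H0 E L n) := InnerProductSpace.ofCore core.toCore
  let b := stdOrthonormalBasis ℂ (H0 E L n)
  have key : ∀ i j, innerK h K q μ n (b i) (b j) = if i = j then 1 else 0 := fun i j =>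
    (orthonormal_iff_ite.1 b.orthonormal j i).trans (by simp [eq_comm])
  have e : ⇑b.toBasis = b := b.coe_toBasis
  exact ⟨b.toBasis, fun i j => (congrArg₂ (innerK h K q μ n) (congrFun e i) (congrFun e j)).trans
    (key i j)⟩

include hK hq in
/-- Parseval's identity. -/
theorem normSqK_eq_sum {S : Module.Basis (Fin (dimH0 E L n)) ℂ (H0 E L n)}
    (hdef : ∀ s : H0 E L n, normSqK h μ K q s = 0 → s = 0)
    (hS : IsOrthonormalBasis h K q μ n S) (s : H0 E L n) :
    normSqK h μ K q s = ∑ j, ‖S.repr s j‖ ^ 2 := by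
  let core := innerKCore h hK hq μ hdef
  let _ : NormedAddCommGroup (H0 E L n) := core.toNormedAddCommGroup
  let _ : InnerProductSpace ℂ (H0 E L n) := InnerProductSpace.ofCore core.toCore
  have hon : Orthonormal ℂ S := by
    rw [orthonormal_iff_ite]
    intro i j
    refine (hS j i).trans ?_
    simp [eq_comm]
  have h1 := hon.inner_sum (S.repr s) (S.repr s) Finset.univ
  rw [S.sum_repr s] at h1
  have h2 : (normSqK h μ K q s : ℂ) = ∑ j, (starRingEnd ℂ) (S.repr s j) * S.repr s j := by
    rw [← innerK_self]
    exact h1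
  have h3 : ∀ z : ℂ, (starRingEnd ℂ) z * z = ((‖z‖ ^ 2 : ℝ) : ℂ) := fun z => by
    rw [mul_comm, Complex.mul_conj, Complex.normSq_eq_norm_sq]
  simp only [h3] at h2
  exact_mod_cast h2

variable {S : Module.Basis (Fin (dimH0 E L n)) ℂ (H0 E L n)}
    (hdef : ∀ s : H0 E L n, normSqK h μ K q s = 0 → s = 0)
    (hS : IsOrthonormalBasis h K q μ n S) (x : X)

include hK hq hdef hS in
theorem le_sqrt_of_mem_phiSet {r : ℝ} (hr : r ∈ phiSet h K q n x) :
    r ≤ Real.sqrt (μ.real K * bergman h n S x) := by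
  obtain ⟨s, hs, rfl⟩ := hr
  refine Real.le_sqrt_of_sq_le ((nrm_sq_le_sum_mul_bergman h S s x).trans ?_)
  rw [← normSqK_eq_sum h hK hq μ hdef hS s]
  exact mul_le_mul_of_nonneg_right (normSqK_le_of_le_one h hK hq μ s hs) (bergman_nonneg h S x)

include hK hq hdef hS in
theorem bddAbove_phiSet : BddAbove (phiSet h K q n x) :=
  ⟨_, fun _ hr => le_sqrt_of_mem_phiSet h hK hq μ hdef hS x hr⟩

include hK hq hdef hS in
theorem Phi_sq_le : Phi h K q n x ^ 2 ≤ μ.real K * bergman h n S x := by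
  have h0 : 0 ≤ μ.real K * bergman h n S x :=
    mul_nonneg measureReal_nonneg (bergman_nonneg h S x)
  have h1 : Phi h K q n x ≤ Real.sqrt (μ.real K * bergman h n S x) :=
    csSup_le ⟨0, zero_mem_phiSet h K q x⟩ fun _ hr => le_sqrt_of_mem_phiSet h hK hq μ hdef hS x hr
  exact (pow_le_pow_left₀ (Phi_nonneg h K q x) h1 2).trans (Real.sq_sqrt h0).le

include hK hq hdef hS in
/-- Each `A^{-1/2} S_j` is admissible in the definition of `Φ_n`. -/
theorem bergman_le {A : ℝ} (hA : 0 < A)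
    (hBM : ∀ s : H0 E L n, ∀ y ∈ K,
      h.nrm n y (val s y) ^ 2 * Real.exp (-(2 * n * q y)) ≤ A * normSqK h μ K q s) :
    bergman h n S x ≤ A * dimH0 E L n * Phi h K q n x ^ 2 := by
  have key : ∀ j, h.nrm n x (val (S j) x) ^ 2 ≤ A * Phi h K q n x ^ 2 := by
    intro j
    have h1 : normSqK h μ K q (S j) = 1 := by
      have := hS j j
      rw [innerK_self, if_pos rfl] at this
      exact_mod_cast this
    have hsA : 0 < Real.sqrt A := Real.sqrt_pos.2 hA
    have hnorm : ‖((Real.sqrt A)⁻¹ : ℂ)‖ = (Real.sqrt A)⁻¹ := by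
      rw [norm_inv, Complex.norm_real, Real.norm_of_nonneg hsA.le]
    have hadm : ∀ y ∈ K, h.nrm n y (val (((Real.sqrt A)⁻¹ : ℂ) • S j) y) *
        Real.exp (-(n * q y)) ≤ 1 := by
      intro y hy
      have h2 := hBM (S j) y hy
      rw [h1, mul_one, show -(2 * n * q y) = ((2 : ℕ) : ℝ) * (-(n * q y)) by push_cast; ring,
        Real.exp_nat_mul, ← mul_pow] at h2
      rw [val_smul, nrm_mul, hnorm, mul_assoc, inv_mul_le_one₀ hsA]
      exact Real.le_sqrt_of_sq_le h2
    have h3 : h.nrm n x (val (((Real.sqrt A)⁻¹ : ℂ) • S j) x) ≤ Phi h K q n x :=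
      le_csSup (bddAbove_phiSet h hK hq μ hdef hS x) ⟨_, hadm, rfl⟩
    rw [val_smul, nrm_mul, hnorm, inv_mul_le_iff₀ hsA] at h3
    refine (pow_le_pow_left₀ (nrm_nonneg h x _) h3 2).trans (le_of_eq ?_)
    rw [mul_pow, Real.sq_sqrt hA.le]
  refine (Finset.sum_le_sum fun j _ => key j).trans (le_of_eq ?_)
  rw [Finset.sum_const, Finset.card_univ, Fintype.card_fin, nsmul_eq_mul]
  ring

end Integral

end Bergman

/-! ### The logarithmic estimate -/

/-- Two-sided polynomial bounds for `B / Φ²` in logarithmic form. The term with `log 2` absorbs the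
constants into a multiple of `log n`, as `n ≥ 2`. -/
theorem abs_log_sub_log_le {B Φ d m N C₀ : ℝ} {n k : ℕ} (hn : 2 ≤ n) (hB : 0 < B) (hΦ : 0 < Φ)
    (hm : 0 < m) (hd : 1 ≤ d) (hC₀ : 0 ≤ C₀) (h1 : Φ ^ 2 ≤ m * d * B)
    (h2 : B ≤ (n : ℝ) ^ C₀ * d * Φ ^ 2) (hdN : d ≤ N * ((n : ℝ) + 1) ^ k) (hN : 1 ≤ N) :
    |1 / (2 * (n : ℝ)) * Real.log B - 1 / (n : ℝ) * Real.log Φ| ≤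
      ((C₀ + 2 * k + (Real.log N + |Real.log m|) / Real.log 2) / 2) * (Real.log n / n) := by
  have hn' : (2 : ℝ) ≤ n := by exact_mod_cast hn
  have hn0 : (0 : ℝ) < n := by linarith
  have hd0 : 0 < d := by linarith
  have hN0 : 0 < N := by linarith
  have hl2 : 0 < Real.log 2 := Real.log_pos (by norm_num)
  have hln : Real.log 2 ≤ Real.log n := Real.log_le_log (by norm_num) hn'
  have e1 := Real.log_le_log (by positivity) h1
  have e2 := Real.log_le_log hB h2
  have e3 := Real.log_le_log hd0 hdN
  have e4 : Real.log ((n : ℝ) + 1) ≤ 2 * Real.log n := by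
    have : Real.log ((n : ℝ) + 1) ≤ Real.log ((n : ℝ) ^ 2) :=
      Real.log_le_log (by linarith) (by nlinarith)
    rwa [Real.log_pow, Nat.cast_two] at this
  rw [Real.log_pow, Real.log_mul (by positivity) hB.ne', Real.log_mul hm.ne' hd0.ne'] at e1
  rw [Real.log_mul (by positivity) (by positivity), Real.log_mul (by positivity) hd0.ne',
    Real.log_rpow hn0, Real.log_pow] at e2
  rw [Real.log_mul hN0.ne' (by positivity), Real.log_pow] at e3
  push_cast at e1 e2
  have e5 : (k : ℝ) * Real.log ((n : ℝ) + 1) ≤ 2 * k * Real.log n := by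
    have := mul_le_mul_of_nonneg_left e4 (Nat.cast_nonneg (α := ℝ) k)
    linarith
  have e6 : Real.log N + |Real.log m| ≤
      (Real.log N + |Real.log m|) / Real.log 2 * Real.log n := by
    rw [div_mul_eq_mul_div, le_div_iff₀ hl2]
    exact mul_le_mul_of_nonneg_left hln (add_nonneg (Real.log_nonneg hN) (abs_nonneg _))
  have e7 : 0 ≤ C₀ * Real.log n := mul_nonneg hC₀ (by linarith)
  have e8 := abs_nonneg (Real.log m)
  have e9 := le_abs_self (Real.log m)
  have main : |Real.log B - 2 * Real.log Φ| ≤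
      (C₀ + 2 * k + (Real.log N + |Real.log m|) / Real.log 2) * Real.log n := by
    rw [abs_le]
    constructor <;> nlinarith
  have e10 : 1 / (2 * (n : ℝ)) * Real.log B - 1 / (n : ℝ) * Real.log Φ =
      (Real.log B - 2 * Real.log Φ) / (2 * n) := by
    field_simp
  rw [e10, abs_div, abs_of_pos (by positivity : (0 : ℝ) < 2 * n), div_le_iff₀ (by positivity)]
  refine main.trans (le_of_eq ?_)
  field_simp

end HolLineBundle

theorem proposition4p1
    {E : Type*} [NormedAddCommGroup E] [NormedSpace ℂ E] [FiniteDimensional ℂ E]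
    {X : Type*} [TopologicalSpace X] [ChartedSpace E X] [IsManifold 𝓘(ℂ, E) ω X]
    [T2Space X] [CompactSpace X] [ConnectedSpace X] [MeasurableSpace X] [BorelSpace X]
    {ι : Type*} (L : VectorBundleCore ℂ X ℂ ι) [L.IsContMDiff 𝓘(ℂ, E) ω]
    (h : HolLineBundle.SmoothMetric E L) (hpos : h.IsPositive)
    (K : Set X) (hK : IsCompact K) (hKpp : ¬ HolLineBundle.IsPluripolar E K)
    (q : X → ℝ) (hq : ContinuousOn q K)
    (μ : Measure X) [IsFiniteMeasure μ] (hμ : μ Kᶜ = 0) (hμK : 0 < μ K)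
    (C₀ : ℝ) (hC₀ : 0 < C₀) (n₀ : ℕ) (hn₀ : 1 ≤ n₀)
    (hBM : HolLineBundle.BernsteinMarkov h K q μ C₀ n₀) :
    (∀ n ≥ n₀,
      FiniteDimensional ℂ (HolLineBundle.H0 E L n) ∧
      (∃ S, HolLineBundle.IsOrthonormalBasis h K q μ n S) ∧
      (∀ x, BddAbove (HolLineBundle.phiSet h K q n x)) ∧
      ∀ S, HolLineBundle.IsOrthonormalBasis h K q μ n S → ∀ x : X,
        HolLineBundle.Phi h K q n x ^ 2 ≤
          μ.real K * HolLineBundle.dimH0 E L n * HolLineBundle.bergman h n S x ∧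
        HolLineBundle.bergman h n S x ≤
          (n : ℝ) ^ C₀ * HolLineBundle.dimH0 E L n * HolLineBundle.Phi h K q n x ^ 2 ∧
        ((∃ s : HolLineBundle.H0 E L n, s x ≠ 0) →
          0 < HolLineBundle.Phi h K q n x ∧ 0 < HolLineBundle.bergman h n S x ∧
          1 / (μ.real K * HolLineBundle.dimH0 E L n) ≤
            HolLineBundle.bergman h n S x / HolLineBundle.Phi h K q n x ^ 2 ∧
          HolLineBundle.bergman h n S x / HolLineBundle.Phi h K q n x ^ 2 ≤
            (n : ℝ) ^ C₀ * HolLineBundle.dimH0 E L n)) ∧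
    ∃ C : ℝ, ∀ n ≥ n₀, 2 ≤ n →
      ∀ S, HolLineBundle.IsOrthonormalBasis h K q μ n S →
        ∀ x : X, (∃ s : HolLineBundle.H0 E L n, s x ≠ 0) →
          |1 / (2 * (n : ℝ)) * Real.log (HolLineBundle.bergman h n S x) -
              1 / (n : ℝ) * Real.log (HolLineBundle.Phi h K q n x)| ≤
            C * (Real.log n / n) := by
  have hdimN := HolLineBundle.exists_dimH0_le (L := L) h
  obtain ⟨N, hN⟩ := hdimN
  have hm : 0 < μ.real K := ENNReal.toReal_pos hμK.ne' (measure_ne_top μ K)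
  obtain ⟨M, hM⟩ := hBM
  have hBM' : ∀ n ≥ n₀, ∀ s : HolLineBundle.H0 E L n, ∀ y ∈ K,
      h.nrm n y (HolLineBundle.val s y) ^ 2 * Real.exp (-(2 * n * q y)) ≤
        (n : ℝ) ^ C₀ * HolLineBundle.normSqK h μ K q s := fun n hn s y hy =>
    ((hM n hn).2 s y hy).trans
      (mul_le_mul_of_nonneg_right (hM n hn).1 (HolLineBundle.normSqK_nonneg h μ s))
  have hdef : ∀ n ≥ n₀, ∀ s : HolLineBundle.H0 E L n,
      HolLineBundle.normSqK h μ K q s = 0 → s = 0 := by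
    intro n hn s hs
    refine HolLineBundle.eq_zero_of_eqOn_zero h hKpp s fun y hy => ?_
    have h1 := hBM' n hn s y hy
    rw [hs, mul_zero] at h1
    have h2 := nonpos_of_mul_nonpos_left h1 (Real.exp_pos _)
    exact pow_eq_zero_iff two_ne_zero |>.1 (le_antisymm h2 (sq_nonneg _))
  have hA : ∀ n ≥ n₀, (0 : ℝ) < (n : ℝ) ^ C₀ := fun n hn =>
    Real.rpow_pos_of_pos (by exact_mod_cast hn₀.trans hn) _
  have hd : ∀ n, (∃ s : HolLineBundle.H0 E L n, s ≠ 0) → 1 ≤ HolLineBundle.dimH0 E L n := by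
    rintro n ⟨s, hs⟩
    have := (hN n).1
    have := nontrivial_of_ne s 0 hs
    exact Module.finrank_pos
  have hne : ∀ n (x : X) (s : HolLineBundle.H0 E L n), HolLineBundle.val s x ≠ 0 → s ≠ 0 := by
    rintro n x s hs rfl
    exact hs (HolLineBundle.val_zero x)
  have hupper : ∀ n ≥ n₀, ∀ S, HolLineBundle.IsOrthonormalBasis h K q μ n S → ∀ x : X,
      HolLineBundle.Phi h K q n x ^ 2 ≤
        μ.real K * HolLineBundle.dimH0 E L n * HolLineBundle.bergman h n S x := by
    intro n hn S hS x
    have h1 := HolLineBundle.Phi_sq_le h hK hq μ (hdef n hn) hS x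
    have hB := HolLineBundle.bergman_nonneg h S x
    -- for `d_n = 0` the factor `d_n` cannot be inserted, but then both sides vanish
    rcases Nat.eq_zero_or_pos (HolLineBundle.dimH0 E L n) with h0 | hpos'
    · have hB0 : HolLineBundle.bergman h n S x = 0 :=
        Finset.sum_eq_zero fun j _ => absurd j.2 (by omega)
      rw [hB0, mul_zero] at h1 ⊢
      exact h1
    · refine h1.trans (mul_le_mul_of_nonneg_right ?_ hB)
      exact le_mul_of_one_le_right hm.le (by exact_mod_cast hpos')
  have hlower : ∀ n ≥ n₀, ∀ S, HolLineBundle.IsOrthonormalBasis h K q μ n S → ∀ x : X,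
      HolLineBundle.bergman h n S x ≤
        (n : ℝ) ^ C₀ * HolLineBundle.dimH0 E L n * HolLineBundle.Phi h K q n x ^ 2 :=
    fun n hn S hS x =>
      HolLineBundle.bergman_le h hK hq μ (hdef n hn) hS x (hA n hn) (hBM' n hn)
  have hPhi : ∀ n ≥ n₀, ∀ S, HolLineBundle.IsOrthonormalBasis h K q μ n S → ∀ x : X,
      0 < HolLineBundle.bergman h n S x → 0 < HolLineBundle.Phi h K q n x := by
    intro n hn S hS x hB
    refine lt_of_le_of_ne (HolLineBundle.Phi_nonneg h K q x) fun h0 => ?_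
    have h1 := hlower n hn S hS x
    rw [← h0] at h1
    simp only [ne_eq, OfNat.ofNat_ne_zero, not_false_eq_true, zero_pow, mul_zero] at h1
    exact absurd h1 (not_le.2 hB)
  refine ⟨fun n hn => ?_, ?_⟩
  · have := (hN n).1
    obtain ⟨S₀, hS₀⟩ := HolLineBundle.exists_isOrthonormalBasis h hK hq μ (hdef n hn)
    refine ⟨this, ⟨S₀, hS₀⟩,
      fun x => HolLineBundle.bddAbove_phiSet h hK hq μ (hdef n hn) hS₀ x,
      fun S hS x => ⟨hupper n hn S hS x, hlower n hn S hS x, ?_⟩⟩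
    rintro ⟨s, hs⟩
    have hB := HolLineBundle.bergman_pos h S hs
    have hP := hPhi n hn S hS x hB
    have hdpos : (0 : ℝ) < HolLineBundle.dimH0 E L n := by
      exact_mod_cast hd n ⟨s, hne n x s hs⟩
    refine ⟨hP, hB, ?_, ?_⟩
    · rw [div_le_div_iff₀ (mul_pos hm hdpos) (pow_pos hP 2), one_mul, mul_comm]
      exact hupper n hn S hS x
    · rw [div_le_iff₀ (pow_pos hP 2)]
      exact hlower n hn S hS x
  · refine ⟨(C₀ + 2 * (Module.finrank ℂ E + 1 : ℕ) +
      (Real.log N + |Real.log (μ.real K)|) / Real.log 2) / 2, fun n hn hn2 S hS x ⟨s, hs⟩ => ?_⟩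
    have hB := HolLineBundle.bergman_pos h S hs
    have hd1 := hd n ⟨s, hne n x s hs⟩
    have hdN := (hN n).2
    have hN1 : 1 ≤ N := by
      rcases Nat.eq_zero_or_pos N with h0 | h0
      · rw [h0, zero_mul] at hdN
        omega
      · exact h0
    exact HolLineBundle.abs_log_sub_log_le hn2 hB (hPhi n hn S hS x hB) hm
      (by exact_mod_cast hd1) hC₀.le (hupper n hn S hS x) (hlower n hn S hS x)
      (N := N) (k := Module.finrank ℂ E + 1) (by exact_mod_cast hdN) (by exact_mod_cast hN1)
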